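/- **Theorem (rate of state-assisted decoding with $q$ state bits).** Let $A,E,\beta,\gamma>0$, $N=\lceil\log_2(\gamma(A+2\beta))\rceil$, $Q(x)=\frac1{\sqrt{2\pi}}\int_x^\infty e^{-u^2/2}\,du$ and $\bar\epsilon=2Q(\beta)$. *Noise.* Let $Z$ be standard Gaussian, conditioned on $-\lceil\gamma A\rceil\le\gamma(Z+\beta)<\lceil\gamma(A+2\beta)\rceil$. Put $\hat Z=\gamma(Z+\beta)+2^N\mathbf 1\{\gamma(Z+\beta)<0\}$, $Z_i^b=\lfloor \hat Z/2^i\rfloor \bmod 2$ for $0\le i\le N-1$, and $Z_j^b=0$ for $j<0$. *Channel.* The vector binary channel with erasure probability $\epsilon$ has input $(X_0^b,\dots,X_{N-1}^b)\in\{0,1\}^N$. With probability $\epsilon$, independently of input and noise, the whole output is erased ($Y_i^c=\xi$ for all $i$). Otherwise $Y_i^c=Y_i^b=(X_i^b+Z_i^b+W_i^b)\bmod 2$, where $W_0^b=0$ and $W_{i}^b=(X_{i-1}^bZ_{i-1}^b+X_{i-1}^bW_{i-1}^b+Z_{i-1}^bW_{i-1}^b)\bmod 2$. The channel is memoryless,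 the noise is independent of the input, and the transmitted intensity is $X=\frac1\gamma\sum_i 2^iX_i^b$. *Scheme SD$_q$.* Let $1\le q\le N-1$ and, for each $i\in\{0,\dots,N-1\}$, let $\mathcal A_i\subseteq\{i-N+1,\dots,i-1\}$ with $|\mathcal A_i|=q$. Put $\boldsymbol S_i^b=(Z_a^b)_{a\in\mathcal A_i}$. The message is split into independent messages $m_0,\dots,m_{N-1}$, and $m_i$ is encoded separately into a binary codeword on bit-pipe $i$. The receiver decodes $m_0,m_1,\dots,m_{N-1}$ in this order. From its previous decisions it reconstructs, at unerased times, the noise bits of the lower bit-pipes and the carry-over $W_i^b$; it decodes $m_i$ only from the streams $\bar Y_i^c(t)$ (equal to $(Y_i^b(t)+W_i^b(t))\bmod 2$, or $\xi$ if erased) and $\boldsymbol S_i^c(t)$ (equal to $\boldsymbol S_i^b(t)$, or $\xi$ if erased). *Rate.* Let $\mathsf h$ be the binary entropy function in bits, $p\circledast a=p(1-a)+(1-p)a$ and $\alpha_i(\boldsymbol s)=\mathcal P\{Z_i^b=1\mid \boldsymbol S_i^b=\boldsymbol s\}$. Then $$R_{\mathrm{SD}_q}=(1-\bar\epsilon)\max_{(p_i)}\sum_{i=0}^{N-1}\mathbb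 E_{\boldsymbol S_i^b}\big[\mathsf h(p_i\circledast\alpha_i(\boldsymbol S_i^b))-\mathsf h(\alpha_i(\boldsymbol S_i^b))\big],$$ where the maximum is over all $p_0,\dots,p_{N-1}\in[0,1]$ with $\sum_{i:p_i\ne0}2^i\le\gamma A$ and $\sum_{i:p_i\neq 0}p_i2^i\le\gamma E$, exists, and is attained at some $(p_i)$ such that, for every erasure probability $\epsilon\in[0,\bar\epsilon]$, in particular for $\epsilon=\bar\epsilon$, SD$_q$ with bit probabilities $(p_i)$ achieves the rate $R_{\mathrm{SD}_q}$. That is, for every $\delta>0$ and all sufficiently large $n$ there is such a scheme of block length $n$, of rate at least $R_{\mathrm{SD}_q}-\delta$ bits per channel use, such that the probability that any $m_i$ is decoded wrongly is at most $\delta$ for every choice of the messages; the transmitted intensity always satisfies $0\le X(t)\le A$, and $\frac1n\sum_{t}X(t)\le E$ for every choice of the messages; the fraction of ones in every codeword of bit-pipe $i$ is within $\delta$ of $p_i$; and bit-pipes with $p_i=0$ send only zeros. -/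

import Mathlib

open MeasureTheory ProbabilityTheory Filter
open scoped ENNReal

/-- Gaussian tail function `Q(x)`. -/
noncomputable def gaussQ (x : ℝ) : ℝ :=
  1 / Real.sqrt (2 * Real.pi) * ∫ u in Set.Ioi x, Real.exp (-u ^ 2 / 2)

/-- Upper bound `2 Q(β)` on the erasure probability. -/
noncomputable def epsBar (β : ℝ) : ℝ := 2 * gaussQ β

/-- Number of bit-pipes, `⌈log₂ (γ (A + 2 β))⌉`. -/
noncomputable def numPipes (A β γ : ℝ) : ℕ := ⌈Real.logb 2 (γ * (A + 2 * β))⌉₊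

/-- Binary entropy in bits. -/
noncomputable def binEnt (p : ℝ) : ℝ := Real.binEntropy p / Real.log 2

/-- Binary convolution `p ⊛ a`. -/
def binConv (p a : ℝ) : ℝ := p * (1 - a) + (1 - p) * a

/-! ### The binary noise -/

/-- The nonnegative representative of the biased and scaled noise `γ (z + β)`:
two's complement is used for negative values. -/
noncomputable def zHat (N : ℕ) (β γ z : ℝ) : ℝ :=
  (if γ * (z + β) < 0 then (2 : ℝ) ^ N else 0) + γ * (z + β)

/-- The `N` noise bits of the real noise sample `z`, least significant bit first. -/
noncomputable def noiseBits (N : ℕ) (β γ z : ℝ) : Fin N → Bool :=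
  fun i => decide (⌊zHat N β γ z / (2 : ℝ) ^ (i : ℕ)⌋ % 2 = 1)

theorem measurable_noiseBits (N : ℕ) (β γ : ℝ) : Measurable (noiseBits N β γ) := by
  have hz : Measurable (zHat N β γ) := by
    unfold zHat
    refine Measurable.add (Measurable.ite ?_ measurable_const measurable_const) (by fun_prop)
    exact measurableSet_lt (by fun_prop) measurable_const
  refine measurable_pi_iff.2 fun i => ?_
  have h1 : Measurable fun z => ⌊zHat N β γ z / (2 : ℝ) ^ (i : ℕ)⌋ :=
    (hz.div_const _).floor
  exact (measurable_of_countable fun k : ℤ => decide (k % 2 = 1)).comp h1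

/-- The input-independent support of the noise given that there is no erasure:
`-⌈γ A⌉ ≤ γ (z + β) < ⌈γ (A + 2 β)⌉`. -/
def noiseSupport (A β γ : ℝ) : Set ℝ :=
  {z | -(⌈γ * A⌉ : ℝ) ≤ γ * (z + β) ∧ γ * (z + β) < (⌈γ * (A + 2 * β)⌉ : ℝ)}

/-- Joint law of the `N` noise bits: the standard Gaussian law, restricted to the support above and
normalized, is pushed forward to bits. -/
noncomputable def noiseLaw (A β γ : ℝ) : Measure (Fin (numPipes A β γ) → Bool) :=
  ((gaussianReal 0 1)[|noiseSupport A β γ]).map (noiseBits (numPipes A β γ) β γ)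

/-! ### The states and the rate expression -/

/-- The noise bit with integer index `j`; it is `0` outside `{0, …, N - 1}`. -/
def extBit {N : ℕ} (z : Fin N → Bool) (j : ℤ) : Bool :=
  if h : 0 ≤ j ∧ j < N then z ⟨j.toNat, by omega⟩ else false

/-- The state vector `(Z_a)_{a ∈ S}`. -/
def stateVec {N : ℕ} (S : Finset ℤ) (z : Fin N → Bool) : S → Bool := fun a => extBit z a

/-- `α_i(s) = P(Z_i = 1 | S_i = s)`. -/
noncomputable def alphaState (A β γ : ℝ) (S : Finset ℤ) (i : Fin (numPipes A β γ))
    (s : S → Bool) : ℝ :=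
  ((noiseLaw A β γ)[|{z | stateVec S z = s}]).real {z | z i = true}

/-- `∑_i E_{S_i} [h(p_i ⊛ α_i(S_i)) - h(α_i(S_i))]`. -/
noncomputable def sdSum (A β γ : ℝ) (𝒜 : Fin (numPipes A β γ) → Finset ℤ)
    (p : Fin (numPipes A β γ) → ℝ) : ℝ :=
  ∑ i, ∫ z, (binEnt (binConv (p i) (alphaState A β γ (𝒜 i) i (stateVec (𝒜 i) z)))
    - binEnt (alphaState A β γ (𝒜 i) i (stateVec (𝒜 i) z))) ∂(noiseLaw A β γ)

/-- The admissible `(p_i)`: the peak constraint is on the set of `on' bit-pipes (`p_i ≠ 0`). -/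
def feasibleInputs (A E β γ : ℝ) : Set (Fin (numPipes A β γ) → ℝ) :=
  {p | (∀ i, 0 ≤ p i ∧ p i ≤ 1) ∧
    (∑ i with p i ≠ 0, (2 : ℝ) ^ (i : ℕ)) ≤ γ * A ∧
    (∑ i with p i ≠ 0, p i * (2 : ℝ) ^ (i : ℕ)) ≤ γ * E}

/-! ### The vector binary channel with erasures -/

/-- Carry-over of the modulo-2 addition of three bits, `xz + xw + zw mod 2`. -/
def carryBit (x z w : Bool) : Bool := ((x && z) ^^ (x && w)) ^^ (z && w)

/-- The carry-over bit `W_k` entering bit-pipe `k`. -/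
def carryOver {N : ℕ} (x z : Fin N → Bool) : ℕ → Bool
  | 0 => false
  | k + 1 => if h : k < N then carryBit (x ⟨k, h⟩) (z ⟨k, h⟩) (carryOver x z k) else false

/-- Unerased output `Y_i = X_i + Z_i + W_i mod 2`. -/
def vbcOut {N : ℕ} (x z : Fin N → Bool) : Fin N → Bool :=
  fun i => (x i ^^ z i) ^^ carryOver x z i

/-- Output with erasures; an erasure (`none`, when `e = true`) hits all bit-pipes of one channel use
simultaneously. -/
def vbcErasedOut {N : ℕ} (x z : Fin N → Bool) (e : Bool) : Option (Fin N → Bool) :=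
  if e then none else some (vbcOut x z)

/-- Bernoulli law of the erasure indicator, with `P(true) = ε`. -/
noncomputable def erasureLaw (ε : ℝ) : Measure Bool :=
  ENNReal.ofReal ε • Measure.dirac true + ENNReal.ofReal (1 - ε) • Measure.dirac false

/-- Law of the noise bits and the erasure indicators in `n` independent channel uses. -/
noncomputable def blockLaw (A β γ ε : ℝ) (n : ℕ) :
    Measure (Fin n → (Fin (numPipes A β γ) → Bool) × Bool) :=
  Measure.pi fun _ => (noiseLaw A β γ).prod (erasureLaw ε)

/-! ### State-assisted decoding -/

/-- A state-assisted scheme of block length `n`: bit-pipe `i` has its own message set and its own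
encoder, and its decoder sees only the stream of carry-free outputs of bit-pipe `i` and the stream
of states `(Z_a)_{a ∈ 𝒜 i}`, both with erasures. -/
structure SDScheme {N : ℕ} (𝒜 : Fin N → Finset ℤ) (n : ℕ) where
  /-- number of messages of each bit-pipe -/
  M : Fin N → ℕ
  /-- encoders -/
  enc : ∀ i, Fin (M i) → Fin n → Bool
  /-- decoders -/
  dec : ∀ i, (Fin n → Option Bool) → (Fin n → Option (𝒜 i → Bool)) → Fin (M i)

namespace SDScheme

variable {N : ℕ} {𝒜 : Fin N → Finset ℤ} {n : ℕ}

/-- The binary vector that is sent at time `t`. -/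
def inputBits (c : SDScheme 𝒜 n) (m : ∀ i, Fin (c.M i)) (t : Fin n) : Fin N → Bool :=
  fun i => c.enc i (m i) t

/-- The intensity `X(t) = (1/γ) ∑_i X_i(t) 2^i` that is sent at time `t`. -/
noncomputable def intensity (c : SDScheme 𝒜 n) (γ : ℝ) (m : ∀ i, Fin (c.M i)) (t : Fin n) : ℝ :=
  (∑ i, if c.inputBits m t i then (2 : ℝ) ^ (i : ℕ) else 0) / γ

/-- The decision on the message of bit-pipe `i`, given the block `y` of channel outputs,
the receiver's reconstruction `z` of the noise bits of lower bit-pipes and its reconstruction `w`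
of the carry-over into bit-pipe `i`. -/
def decision (c : SDScheme 𝒜 n) (y : Fin n → Option (Fin N → Bool)) (i : Fin N)
    (z : Fin n → ℤ → Bool) (w : Fin n → Bool) : Fin (c.M i) :=
  c.dec i (fun t => (y t).map fun v => v i ^^ w t) (fun t => (y t).map fun _ a => z t a)

/-- What the receiver has reconstructed after it has decoded the bit-pipes below `k`: the noise bits
of these bit-pipes (all other bits are `0`) and the carry-over into bit-pipe `k`. The
reconstruction uses the decoded messages, so wrong decisions propagate. At erased times
the values are immaterial. -/
def receiver (c : SDScheme 𝒜 n) (y : Fin n → Option (Fin N → Bool)) :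
    ℕ → (Fin n → ℤ → Bool) × (Fin n → Bool)
  | 0 => (fun _ _ => false, fun _ => false)
  | k + 1 =>
    let z := (c.receiver y k).1
    let w := (c.receiver y k).2
    if h : k < N then
      let x : Fin n → Bool := c.enc ⟨k, h⟩ (c.decision y ⟨k, h⟩ z w)
      let zk : Fin n → Bool := fun t => (y t).elim false fun v => (v ⟨k, h⟩ ^^ w t) ^^ x t
      (fun t => Function.update (z t) k (zk t), fun t => carryBit (x t) (zk t) (w t))
    else (z, w)

/-- The decoded message of bit-pipe `i`. -/
def decoded (c : SDScheme 𝒜 n) (y : Fin n → Option (Fin N → Bool)) (i : Fin N) : Fin (c.M i) :=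
  c.decision y i (c.receiver y i).1 (c.receiver y i).2

/-- The block of channel outputs. -/
def output (c : SDScheme 𝒜 n) (m : ∀ i, Fin (c.M i)) (ω : Fin n → (Fin N → Bool) × Bool) :
    Fin n → Option (Fin N → Bool) :=
  fun t => vbcErasedOut (c.inputBits m t) (ω t).1 (ω t).2

end SDScheme

/-- Probability that some bit-pipe is decoded wrongly when the messages `m` are sent. -/
noncomputable def sdErrorProb (A β γ ε : ℝ) {𝒜 : Fin (numPipes A β γ) → Finset ℤ} {n : ℕ}
    (c : SDScheme 𝒜 n) (m : ∀ i, Fin (c.M i)) : ℝ :=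
  (blockLaw A β γ ε n).real {ω | ∃ i, c.decoded (c.output m ω) i ≠ m i}

/-- The scheme uses inputs with bit probabilities `p`, up to `δ`, and satisfies the
peak constraint `A` at all times and the average constraint `E` on every codeword. -/
def SDScheme.Admissible {N : ℕ} {𝒜 : Fin N → Finset ℤ} {n : ℕ} (c : SDScheme 𝒜 n)
    (A E γ : ℝ) (p : Fin N → ℝ) (δ : ℝ) : Prop :=
  (∀ i, p i = 0 → ∀ m t, c.enc i m t = false) ∧
  (∀ i m, |((Finset.univ.filter fun t => c.enc i m t = true).card : ℝ) / n - p i| ≤ δ) ∧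
  (∀ m t, c.intensity γ m t ≤ A) ∧
  (∀ m, (∑ t, c.intensity γ m t) / n ≤ E)

/-- The rate `R` (in bits per channel use) is achieved by state-assisted decoding with input
probabilities `p`: for all large block lengths there are schemes whose rate is at least `R - δ` and
whose maximal error probability is at most `δ`. -/
def SDAchieves (A E β γ ε : ℝ) (𝒜 : Fin (numPipes A β γ) → Finset ℤ)
    (p : Fin (numPipes A β γ) → ℝ) (R : ℝ) : Prop :=
  ∀ δ : ℝ, 0 < δ → ∀ᶠ n : ℕ in atTop, ∃ c : SDScheme 𝒜 n,
    c.Admissible A E γ p δ ∧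
    R - δ ≤ (∑ i, Real.logb 2 (c.M i)) / n ∧
    ∀ m, sdErrorProb A β γ ε c m ≤ δ

/-!
When the decisions on the lower bit-pipes are right, the receiver knows the carry-over and the
state, so bit-pipe `i` behaves like an isolated memoryless channel that outputs `(X_i + Z_i, S_i)`
or an erasure. By the union bound it is enough to code for each of these channels separately. The
mutual information of the channel is `1 - ε` times `E[h(p_i ⊛ α_i(S_i)) - h(α_i(S_i))]`.

Feinstein's greedy construction gives codes with small maximal error probability, and restricting
the typical set to input blocks with a typical fraction of ones controls every single codeword. The
codes are built for a bit probability slightly below `p_i`, so that the fraction of ones never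
exceeds `p_i` and the energy constraint holds without loss.

The maximum exists because the feasible set is the union, over the finitely many sets of bit-pipes
that satisfy the peak constraint, of compact sets, and the rate is continuous.
-/

/-! ### Coding for memoryless channels -/

section WeakLaw

variable {Ω : Type*} [MeasurableSpace Ω] {μ : Measure Ω} [IsProbabilityMeasure μ]

theorem pi_le_abs_sum_sub_le_variance {f : Ω → ℝ} (hf : MemLp f 2 μ) {δ : ℝ} (hδ : 0 < δ)
    {n : ℕ} (hn : 0 < n) :
    Measure.pi (fun _ : Fin n => μ) {v | n * δ ≤ |∑ t, f (v t) - n * μ[f]|} ≤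
      ENNReal.ofReal (Var[f; μ] / δ ^ 2 / n) := by
  have hmemLp (t : Fin n) :
      MemLp (fun v : Fin n → Ω => f (v t)) 2 (Measure.pi fun _ => μ) :=
    hf.comp_measurePreserving (measurePreserving_eval (fun _ => μ) t)
  have hmean : ∫ v, (∑ t, fun v : Fin n → Ω => f (v t)) v ∂Measure.pi (fun _ => μ) =
      n * μ[f] := by
    simp only [Finset.sum_apply]
    rw [integral_finsetSum _ fun t _ => (hmemLp t).integrable one_le_two]
    simp [integral_comp_eval (μ := fun _ : Fin n => μ) hf.aestronglyMeasurable]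
  have hvar : Var[∑ t, fun v : Fin n → Ω => f (v t); Measure.pi fun _ => μ] =
      n * Var[f; μ] := by
    simp [variance_sum_pi fun _ : Fin n => hf]
  have hchebyshev := meas_ge_le_variance_div_sq (memLp_finsetSum' Finset.univ fun t _ => hmemLp t)
    (c := n * δ) (by positivity)
  rw [hmean, hvar] at hchebyshev
  simp only [Finset.sum_apply] at hchebyshev
  exact hchebyshev.trans_eq (by congr 1; field_simp)

theorem tendsto_pi_le_abs_sum_sub {f : Ω → ℝ} (hf : MemLp f 2 μ) {δ : ℝ} (hδ : 0 < δ) :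
    Tendsto (fun n : ℕ =>
        Measure.pi (fun _ : Fin n => μ) {v | n * δ ≤ |∑ t, f (v t) - n * μ[f]|})
      atTop (nhds 0) := by
  have hbound : Tendsto (fun n : ℕ => ENNReal.ofReal (Var[f; μ] / δ ^ 2 / n)) atTop (nhds 0) := by
    simpa using ENNReal.tendsto_ofReal (tendsto_const_div_atTop_nhds_zero_nat (Var[f; μ] / δ ^ 2))
  refine tendsto_of_tendsto_of_tendsto_of_le_of_le' tendsto_const_nhds hbound
    (Eventually.of_forall fun _ => zero_le) ?_
  filter_upwards [eventually_gt_atTop 0] with n hn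
  exact pi_le_abs_sum_sub_le_variance hf hδ hn

end WeakLaw

theorem exists_eq_of_mem_of_pairwise_disjoint {Y ι : Type*} [Nonempty ι] {D : ι → Set Y}
    (hD : Pairwise fun j k => Disjoint (D j) (D k)) :
    ∃ φ : Y → ι, ∀ j, ∀ y ∈ D j, φ y = j := by
  refine ⟨fun y => Classical.epsilon fun j => y ∈ D j, fun j y hy => ?_⟩
  have hmem : y ∈ D (Classical.epsilon fun j => y ∈ D j) :=
    Classical.epsilon_spec (p := fun j => y ∈ D j) ⟨j, hy⟩
  exact hD.eq (Set.not_disjoint_iff.2 ⟨y, hmem, hy⟩)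

section Feinstein

variable {X Y : Type*} [MeasurableSpace X] [MeasurableSpace Y]
  {P : Measure X} [IsProbabilityMeasure P] {W : Kernel X Y} [IsMarkovKernel W]

theorem exists_measure_compl_diff_lt {T : Set (X × Y)} (hT : MeasurableSet T) {U : Set Y}
    (hU : MeasurableSet U) {η : ℝ≥0∞} (h : (P ⊗ₘ W) Tᶜ + (W ∘ₘ P) U < η) :
    ∃ x, W x (Prod.mk x ⁻¹' T \ U)ᶜ < η := by
  have hmeas : Measurable fun x => W x (Prod.mk x ⁻¹' Tᶜ) :=
    Kernel.measurable_kernel_prodMk_left hT.compl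
  obtain ⟨x, hx⟩ := exists_le_lintegral (μ := P) (f := fun x => W x (Prod.mk x ⁻¹' Tᶜ) + W x U)
    (hmeas.add (W.measurable_coe hU)).aemeasurable
  rw [lintegral_add_left hmeas, ← Measure.compProd_apply hT.compl,
    ← Measure.bind_apply hU W.aemeasurable] at hx
  refine ⟨x, lt_of_le_of_lt ?_ (hx.trans_lt h)⟩
  calc W x (Prod.mk x ⁻¹' T \ U)ᶜ = W x (Prod.mk x ⁻¹' Tᶜ ∪ U) := by
        rw [Set.sdiff_eq, Set.compl_inter, compl_compl, Set.preimage_compl]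
    _ ≤ W x (Prod.mk x ⁻¹' Tᶜ) + W x U := measure_union_le _ _

/-- A code with maximal error probability below `η`: codewords with disjoint decoding sets. -/
structure IsDisjointCode (W : Kernel X Y) (η : ℝ≥0∞) {M : ℕ} (c : Fin M → X)
    (D : Fin M → Set Y) : Prop where
  measurableSet : ∀ j, MeasurableSet (D j)
  pairwise_disjoint : Pairwise fun j k => Disjoint (D j) (D k)
  error_lt : ∀ j, W (c j) (D j)ᶜ < η

/- Greedy construction: the new codeword decodes to its section of `T` minus the decoding sets of
the previous codewords, which jointly have output measure at most `k * κ`. -/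
theorem exists_isDisjointCode {T : Set (X × Y)} (hT : MeasurableSet T) {κ η : ℝ≥0∞}
    (hκ : ∀ x, (W ∘ₘ P) (Prod.mk x ⁻¹' T) ≤ κ) {M : ℕ}
    (hη : ∀ k < M, (P ⊗ₘ W) Tᶜ + k * κ < η) :
    ∃ (c : Fin M → X) (D : Fin M → Set Y), IsDisjointCode W η c D ∧
      ∀ j, D j ⊆ Prod.mk (c j) ⁻¹' T := by
  induction M with
  | zero =>
    exact ⟨Fin.elim0, Fin.elim0, ⟨fun j => j.elim0, fun j => j.elim0, fun j => j.elim0⟩,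
      fun j => j.elim0⟩
  | succ M ih =>
    obtain ⟨c, D, hcode, hDT⟩ := ih fun k hk => hη k (hk.trans M.lt_succ_self)
    have hU : (W ∘ₘ P) (⋃ j, D j) ≤ M * κ :=
      calc (W ∘ₘ P) (⋃ j, D j) ≤ ∑ j, (W ∘ₘ P) (D j) := measure_iUnion_fintype_le _ _
        _ ≤ ∑ _j : Fin M, κ :=
          Finset.sum_le_sum fun j _ => (measure_mono (hDT j)).trans (hκ (c j))
        _ = M * κ := by simp
    have hUmeas : MeasurableSet (⋃ j, D j) := .iUnion hcode.measurableSet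
    obtain ⟨x, hx⟩ := exists_measure_compl_diff_lt hT hUmeas
      ((by gcongr : (P ⊗ₘ W) Tᶜ + _ ≤ _).trans_lt (hη M M.lt_succ_self))
    have hdisj (k : Fin M) : Disjoint (Prod.mk x ⁻¹' T \ ⋃ j, D j) (D k) :=
      Set.disjoint_sdiff_left.mono_right (Set.subset_iUnion D k)
    refine ⟨Fin.cons x c, Fin.cons (Prod.mk x ⁻¹' T \ ⋃ j, D j) D, ⟨?_, ?_, ?_⟩, ?_⟩
    · exact Fin.forall_fin_succ.2 ⟨(measurable_prodMk_left hT).diff hUmeas, hcode.measurableSet⟩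
    · simp only [Pairwise, Fin.forall_fin_succ, Fin.cons_zero, Fin.cons_succ, ne_eq,
        Fin.succ_inj, not_true_eq_false, false_imp_iff, true_and]
      exact ⟨fun k _ => hdisj k, fun k => ⟨fun _ => (hdisj k).symm,
        fun l hkl => hcode.pairwise_disjoint hkl⟩⟩
    · exact Fin.forall_fin_succ.2 ⟨hx, hcode.error_lt⟩
    · exact Fin.forall_fin_succ.2 ⟨Set.sdiff_subset, hDT⟩

theorem exists_feinstein_code {T : Set (X × Y)} (hT : MeasurableSet T)
    {κ η : ℝ≥0∞} (hκ : ∀ x, (W ∘ₘ P) (Prod.mk x ⁻¹' T) ≤ κ) {M : ℕ} (hη1 : η ≤ 1)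
    (hη : (P ⊗ₘ W) Tᶜ + M * κ < η) :
    ∃ (c : Fin (M + 1) → X) (D : Y → Fin (M + 1)), ∀ j,
      (Prod.mk (c j) ⁻¹' T).Nonempty ∧ W (c j) {y | D y ≠ j} < η := by
  obtain ⟨c, D, hcode, hDT⟩ := exists_isDisjointCode hT hκ (M := M + 1) fun k hk =>
    lt_of_le_of_lt (by gcongr; exact Nat.lt_succ_iff.1 hk) hη
  obtain ⟨φ, hφ⟩ := exists_eq_of_mem_of_pairwise_disjoint hcode.pairwise_disjoint
  refine ⟨c, φ, fun j => ⟨?_, ?_⟩⟩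
  · by_contra hempty
    have hDj : D j = ∅ := Set.subset_eq_empty (hDT j) (Set.not_nonempty_iff_eq_empty.1 hempty)
    have h := hcode.error_lt j
    rw [hDj, Set.compl_empty, measure_univ] at h
    exact h.not_ge hη1
  · have hsub : {y | φ y ≠ j} ⊆ (D j)ᶜ := fun y hy hyD => hy (hφ j y hyD)
    exact (measure_mono hsub).trans_lt (hcode.error_lt j)

end Feinstein

section Memoryless

variable {X Y : Type*} [MeasurableSpace X] [MeasurableSpace Y]

theorem lintegral_pi_prod {Ω ι : Type*} [MeasurableSpace Ω] [Fintype ι] (μ : Measure Ω)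
    [IsProbabilityMeasure μ] {f : ι → Ω → ℝ≥0∞} (hf : ∀ t, Measurable (f t)) :
    ∫⁻ x, ∏ t, f t (x t) ∂Measure.pi (fun _ => μ) = ∏ t, ∫⁻ a, f t a ∂μ := by
  rw [lintegral_prod_eq_prod_lintegral_of_indepFun _ (fun t (x : ι → Ω) => f t (x t))
    (iIndepFun_pi fun t => (hf t).aemeasurable) fun t => (hf t).comp (measurable_pi_apply t)]
  exact Finset.prod_congr rfl fun t _ =>
    (measurePreserving_eval (fun _ => μ) t).lintegral_comp (hf t)

/-- The memoryless extension of the channel `W`: given the block `x` of inputs, the outputs at the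
times `t : ι` are independent with laws `W (x t)`. -/
noncomputable def memoryless (W : Kernel X Y) [IsMarkovKernel W] (ι : Type*) [Fintype ι] :
    Kernel (ι → X) (ι → Y) where
  toFun x := Measure.pi fun t => W (x t)
  measurable' := by
    refine .measure_of_isPiSystem_of_isProbabilityMeasure generateFrom_pi.symm isPiSystem_pi ?_
    rintro _ ⟨s, hs, rfl⟩
    simp only [Measure.pi_pi]
    exact Finset.measurable_prod _ fun t _ =>
      (W.measurable_coe (hs t trivial)).comp (measurable_pi_apply t)

variable {W : Kernel X Y} [IsMarkovKernel W] {P : Measure X} [IsProbabilityMeasure P]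
  {ι : Type*} [Fintype ι]

theorem memoryless_apply (x : ι → X) : memoryless W ι x = Measure.pi fun t => W (x t) := rfl

instance : IsMarkovKernel (memoryless W ι) :=
  ⟨fun x => by rw [memoryless_apply]; infer_instance⟩

theorem map_pi_compProd :
    (Measure.pi fun _ => P ⊗ₘ W).map (MeasurableEquiv.arrowProdEquivProdArrow X Y ι) =
      Measure.pi (fun _ => P) ⊗ₘ memoryless W ι := by
  refine (MeasurableEquiv.map_apply_eq_iff_map_symm_apply_eq _).2 (Measure.pi_eq fun s hs => ?_)
  rw [MeasurableEquiv.map_apply,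
    Measure.compProd_apply (MeasurableEquiv.measurable _ (.univ_pi hs))]
  have hsection (x : ι → X) : Prod.mk x ⁻¹'
      ((MeasurableEquiv.arrowProdEquivProdArrow X Y ι).symm ⁻¹' Set.univ.pi s) =
        Set.univ.pi fun t => Prod.mk (x t) ⁻¹' s t := by
    ext y
    simp [MeasurableEquiv.arrowProdEquivProdArrow, Equiv.arrowProdEquivProdArrow]
  simp only [hsection, memoryless_apply, Measure.pi_pi, Measure.compProd_apply (hs _)]
  exact lintegral_pi_prod P fun t => Kernel.measurable_kernel_prodMk_left (hs t)

theorem memoryless_comp_pi :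
    memoryless W ι ∘ₘ Measure.pi (fun _ => P) = Measure.pi fun _ => W ∘ₘ P := by
  rw [← Measure.snd_compProd, ← map_pi_compProd, Measure.snd, ← Measure.snd_compProd,
    Measure.map_map measurable_snd (MeasurableEquiv.measurable _), Measure.snd]
  exact Measure.pi_map_pi fun _ => measurable_snd.aemeasurable

end Memoryless

theorem natFloor_exp_mul_ofReal_exp_neg_le (a b : ℝ) :
    (⌊Real.exp a⌋₊ : ℝ≥0∞) * ENNReal.ofReal (Real.exp (-b)) ≤
      ENNReal.ofReal (Real.exp (a - b)) := by
  rw [← ENNReal.ofReal_natCast, ← ENNReal.ofReal_mul (Nat.cast_nonneg _), sub_eq_add_neg,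
    Real.exp_add]
  gcongr
  exact Nat.floor_le (Real.exp_nonneg _)

section MutualInformation

variable {X Y : Type*} [MeasurableSpace X] [MeasurableSpace Y]
  {P : Measure X} {W : Kernel X Y} [IsMarkovKernel W]

/-- Information density `log (W(y|x) / Q(y))` of an input and an output of the discrete channel `W`,
in nats, where `Q` is the output law for the input law `P`. -/
noncomputable def infoDensity (P : Measure X) (W : Kernel X Y) (a : X × Y) : ℝ :=
  Real.log ((W a.1).real {a.2} / (W ∘ₘ P).real {a.2})

/-- Mutual information of the input and the output of the discrete channel `W` for the input law
`P`, in nats. -/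
noncomputable def mutualInfo (P : Measure X) (W : Kernel X Y) : ℝ :=
  ∫ a, infoDensity P W a ∂(P ⊗ₘ W)

theorem ae_compProd_singleton_ne_zero [Countable X] [DiscreteMeasurableSpace X] [Countable Y]
    [DiscreteMeasurableSpace Y] : ∀ᵐ a ∂P ⊗ₘ W, W a.1 {a.2} ≠ 0 :=
  (Measure.ae_compProd_iff .of_discrete).2 (ae_of_all _ fun _ => ae_iff_of_countable.2 fun _ => id)

theorem measure_le_mul_of_forall_singleton_le {α : Type*} [MeasurableSpace α] [Countable α]
    [MeasurableSingletonClass α] {μ ν : Measure α} {k : ℝ≥0∞} {S : Set α}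
    (h : ∀ a ∈ S, μ {a} ≤ k * ν {a}) : μ S ≤ k * ν S := by
  have hsum (ρ : Measure α) : ρ S = ∑' a : S, ρ {(a : α)} := by
    conv_lhs => rw [← Set.biUnion_of_singleton S]
    exact measure_biUnion S.to_countable
      (fun a _ b _ hab => Set.disjoint_singleton.2 hab) fun a _ => measurableSet_singleton a
  rw [hsum, hsum, ← ENNReal.tsum_mul_left]
  exact ENNReal.tsum_le_tsum fun a => h a a.2

variable [IsProbabilityMeasure P]

theorem comp_singleton_le_exp_neg_infoDensity_mul {x : X} {y : Y} (h : W x {y} ≠ 0) :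
    (W ∘ₘ P) {y} ≤ ENNReal.ofReal (Real.exp (-infoDensity P W (x, y))) * W x {y} := by
  rw [← ofReal_measureReal, ← ofReal_measureReal, ← ENNReal.ofReal_mul (Real.exp_pos _).le]
  refine ENNReal.ofReal_le_ofReal ?_
  have hw : 0 < (W x).real {y} := ENNReal.toReal_pos h (measure_ne_top _ _)
  rcases (measureReal_nonneg (μ := W ∘ₘ P) (s := {y})).eq_or_lt with hq | hq
  · rw [← hq]
    positivity
  · rw [infoDensity, Real.exp_neg, Real.exp_log (div_pos hw hq), inv_div,
      div_mul_cancel₀ _ hw.ne']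

theorem pi_comp_le_exp_neg_of_lt_sum_infoDensity [Countable Y] [MeasurableSingletonClass Y]
    {ι : Type*} [Fintype ι] (x : ι → X) (s : ℝ) :
    Measure.pi (fun _ => W ∘ₘ P)
        {y | (∀ t, W (x t) {y t} ≠ 0) ∧ s < ∑ t, infoDensity P W (x t, y t)} ≤
      ENNReal.ofReal (Real.exp (-s)) := by
  refine (measure_le_mul_of_forall_singleton_le (ν := memoryless W ι x) ?_).trans
    (mul_le_of_le_one_right' prob_le_one)
  rintro y ⟨hne, hlt⟩
  rw [Measure.pi_singleton, memoryless_apply, Measure.pi_singleton]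
  calc ∏ t, (W ∘ₘ P) {y t}
      ≤ ∏ t, (ENNReal.ofReal (Real.exp (-infoDensity P W (x t, y t))) * W (x t) {y t}) :=
        Finset.prod_le_prod' fun t _ => comp_singleton_le_exp_neg_infoDensity_mul (hne t)
    _ = ENNReal.ofReal (Real.exp (-∑ t, infoDensity P W (x t, y t))) * ∏ t, W (x t) {y t} := by
        rw [Finset.prod_mul_distrib, ← ENNReal.ofReal_prod_of_nonneg fun _ _ => Real.exp_nonneg _,
          ← Real.exp_sum, Finset.sum_neg_distrib]
    _ ≤ ENNReal.ofReal (Real.exp (-s)) * ∏ t, W (x t) {y t} := by gcongr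

/-- The pairs of input and output blocks used for decoding: the average of `f` over the input
block is near its mean, and the information density exceeds its mean less `n * δ`. -/
def typicalSet (P : Measure X) (W : Kernel X Y) (f : X → ℝ) (δ : ℝ) (n : ℕ) :
    Set ((Fin n → X) × (Fin n → Y)) :=
  {a | |∑ t, f (a.1 t) - n * P[f]| < n * δ ∧ (∀ t, W (a.1 t) {a.2 t} ≠ 0) ∧
    n * (mutualInfo P W - δ) < ∑ t, infoDensity P W (a.1 t, a.2 t)}

variable [Finite X] [DiscreteMeasurableSpace X] [Finite Y] [DiscreteMeasurableSpace Y]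

theorem tendsto_compProd_memoryless_compl_typicalSet (f : X → ℝ) {δ : ℝ} (hδ : 0 < δ) :
    Tendsto (fun n : ℕ => (Measure.pi (fun _ : Fin n => P) ⊗ₘ memoryless W (Fin n))
      (typicalSet P W f δ n)ᶜ) atTop (nhds 0) := by
  have hf : (P ⊗ₘ W)[fun a => f a.1] = P[f] := by
    rw [← integral_map (f := f) measurable_fst.aemeasurable
      Measurable.of_discrete.aestronglyMeasurable]
    congr 1
    exact Measure.fst_compProd P W
  have hlim := (tendsto_pi_le_abs_sum_sub (.of_discrete : MemLp (fun a => f a.1) 2 (P ⊗ₘ W))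
    hδ).add (tendsto_pi_le_abs_sum_sub (.of_discrete : MemLp (infoDensity P W) 2 (P ⊗ₘ W)) hδ)
  rw [add_zero] at hlim
  refine tendsto_of_tendsto_of_tendsto_of_le_of_le tendsto_const_nhds hlim
    (fun _ => zero_le) fun n => ?_
  rw [← map_pi_compProd, MeasurableEquiv.map_apply]
  refine (measure_mono_ae ?_).trans (measure_union_le _ _)
  have hne : ∀ᵐ v ∂Measure.pi fun _ : Fin n => P ⊗ₘ W, ∀ t, W (v t).1 {(v t).2} ≠ 0 :=
    eventually_all.2 fun t => (Measure.tendsto_eval_ae_ae (μ := fun _ : Fin n => P ⊗ₘ W)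
      (i := t)).eventually ae_compProd_singleton_ne_zero
  filter_upwards [hne] with v hv hmem
  by_contra hnot
  obtain ⟨hmean, hinfo⟩ := not_or.1 hnot
  simp only [Set.mem_ofPred_eq, not_le, hf] at hmean hinfo
  have hlower := (abs_lt.1 hinfo).1
  refine hmem ⟨hmean, hv, ?_⟩
  change n * (mutualInfo P W - δ) < ∑ t, infoDensity P W (v t)
  unfold mutualInfo
  linarith

theorem eventually_exists_memoryless_code (f : X → ℝ) {δ : ℝ} (hδ : 0 < δ) :
    ∀ᶠ n : ℕ in atTop, ∃ M : ℕ, n * (mutualInfo P W - δ) ≤ Real.log M ∧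
      ∃ (c : Fin M → Fin n → X) (D : (Fin n → Y) → Fin M), ∀ j,
        |∑ t, f (c j t) - n * P[f]| < n * δ ∧
        memoryless W (Fin n) (c j) {y | D y ≠ j} ≤ ENNReal.ofReal δ := by
  have hη : 0 < min (ENNReal.ofReal δ) 1 := lt_min (ENNReal.ofReal_pos.2 hδ) one_pos
  have hlim : Tendsto (fun n : ℕ => (Measure.pi (fun _ : Fin n => P) ⊗ₘ memoryless W (Fin n))
      (typicalSet P W f (δ / 2) n)ᶜ + ENNReal.ofReal (Real.exp (-(n * (δ / 2)))))
      atTop (nhds 0) := by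
    have hexp : Tendsto (fun n : ℕ => Real.exp (-(n * (δ / 2)))) atTop (nhds 0) :=
      Real.tendsto_exp_neg_atTop_nhds_zero.comp
        (tendsto_natCast_atTop_atTop.atTop_mul_const (half_pos hδ))
    simpa using (tendsto_compProd_memoryless_compl_typicalSet f (half_pos hδ)).add
      (ENNReal.tendsto_ofReal hexp)
  filter_upwards [hlim.eventually_lt_const hη, eventually_gt_atTop 0] with n hn hn0
  set K := Real.exp (n * (mutualInfo P W - δ))
  set κ := ENNReal.ofReal (Real.exp (-(n * (mutualInfo P W - δ / 2))))
  have hκ (x : Fin n → X) : (memoryless W (Fin n) ∘ₘ Measure.pi fun _ => P)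
      (Prod.mk x ⁻¹' typicalSet P W f (δ / 2) n) ≤ κ := by
    rw [memoryless_comp_pi]
    exact (measure_mono fun y hy => hy.2).trans (pi_comp_le_exp_neg_of_lt_sum_infoDensity x _)
  have hMκ : (⌊K⌋₊ : ℝ≥0∞) * κ ≤ ENNReal.ofReal (Real.exp (-(n * (δ / 2)))) :=
    (natFloor_exp_mul_ofReal_exp_neg_le _ _).trans_eq (by congr 2; ring)
  obtain ⟨c, D, hcode⟩ := exists_feinstein_code .of_discrete hκ (min_le_right _ 1)
    ((by gcongr : _ ≤ _).trans_lt hn)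
  refine ⟨⌊K⌋₊ + 1, ?_, c, D, fun j => ?_⟩
  · rw [Real.le_log_iff_exp_le (by positivity)]
    exact_mod_cast (Nat.lt_floor_add_one K).le
  · obtain ⟨⟨y, hy⟩, herr⟩ := hcode j
    have hn0' : (0 : ℝ) < n := by exact_mod_cast hn0
    exact ⟨hy.1.trans (mul_lt_mul_of_pos_left (half_lt_self hδ) hn0'),
      herr.le.trans (min_le_left _ _)⟩

end MutualInformation

/-! ### A single bit-pipe -/

section BinaryInformation

/-- Probability of the bit `c` under the Bernoulli law with `P(true) = a`. -/
def bitProb (a : ℝ) (c : Bool) : ℝ := if c then a else 1 - a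

theorem bitProb_binConv (p a : ℝ) (c : Bool) :
    bitProb (binConv p a) c = p * bitProb a (!c) + (1 - p) * bitProb a c := by
  cases c
  · simp only [bitProb, binConv, Bool.not_false, if_true, Bool.false_eq_true, if_false]
    ring
  · simp [bitProb, binConv]

theorem mul_log_div_of_le {v d k : ℝ} (hk : 0 ≤ k) (hv : 0 ≤ v) (h : k * v ≤ d) :
    k * v * Real.log (v / d) = k * v * (Real.log v - Real.log d) := by
  by_cases h0 : k * v = 0
  · simp [h0]
  have hkv : 0 < k * v := (mul_nonneg hk hv).lt_of_ne' h0
  rw [Real.log_div (right_ne_zero_of_mul h0) (hkv.trans_le h).ne']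

/-- The left-hand side is the mean information density of a binary symmetric channel with crossover
probability `a`; the sums run over the noise bit. -/
theorem sum_bitProb_mul_log_div {p a : ℝ} (hp : p ∈ unitInterval) (ha : a ∈ unitInterval) :
    p * ∑ c, bitProb a c * Real.log (bitProb a c / bitProb (binConv p a) (!c)) +
      (1 - p) * ∑ c, bitProb a c * Real.log (bitProb a c / bitProb (binConv p a) c) =
    Real.binEntropy (binConv p a) - Real.binEntropy a := by
  have hpa := mul_nonneg hp.1 ha.1
  have hpa' := mul_nonneg hp.1 (sub_nonneg.2 ha.2)
  have hp'a := mul_nonneg (sub_nonneg.2 hp.2) ha.1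
  have hp'a' := mul_nonneg (sub_nonneg.2 hp.2) (sub_nonneg.2 ha.2)
  simp only [Fintype.sum_bool, bitProb, mul_add, ← mul_assoc, Bool.not_true, Bool.not_false,
    if_true, Bool.false_eq_true, if_false]
  rw [mul_log_div_of_le hp.1 ha.1 (by unfold binConv; linarith),
    mul_log_div_of_le hp.1 (sub_nonneg.2 ha.2) (by unfold binConv; linarith),
    mul_log_div_of_le (sub_nonneg.2 hp.2) ha.1 (by unfold binConv; linarith),
    mul_log_div_of_le (sub_nonneg.2 hp.2) (sub_nonneg.2 ha.2) (by unfold binConv; linarith),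
    Real.binEntropy_eq_negMulLog_add_negMulLog_one_sub,
    Real.binEntropy_eq_negMulLog_add_negMulLog_one_sub]
  simp only [Real.negMulLog]
  have hdef : binConv p a = p * (1 - a) + (1 - p) * a := rfl
  linear_combination (Real.log (1 - binConv p a) - Real.log (binConv p a)) * (-hdef)

theorem binEnt_le_binEnt_binConv {p a : ℝ} (hp : p ∈ unitInterval) (ha : a ∈ unitInterval) :
    binEnt a ≤ binEnt (binConv p a) := by
  have h := Real.strictConcave_binEntropy.concaveOn.2
    (⟨sub_nonneg.2 ha.2, sub_le_self 1 ha.1⟩ : 1 - a ∈ Set.Icc (0 : ℝ) 1) ha hp.1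
    (sub_nonneg.2 hp.2) (add_sub_cancel p 1)
  simp only [smul_eq_mul, Real.binEntropy_one_sub] at h
  refine div_le_div_of_nonneg_right ?_ (Real.log_pos one_lt_two).le
  unfold binConv
  linarith

end BinaryInformation

section Conditioning

variable {Z S : Type*} [MeasurableSpace Z]

theorem integral_comp_bool {μ : Measure Z} [IsProbabilityMeasure μ] {b : Z → Bool}
    (hb : Measurable b) (g : Bool → ℝ) :
    ∫ z, g (b z) ∂μ = ∑ c, bitProb (μ.real {z | b z = true}) c * g c := by
  have htrue : (μ.map b).real {true} = μ.real {z | b z = true} :=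
    map_measureReal_apply hb (measurableSet_singleton _)
  have hfalse : (μ.map b).real {false} = 1 - μ.real {z | b z = true} := by
    rw [map_measureReal_apply hb (measurableSet_singleton _),
      ← probReal_compl_eq_one_sub (show MeasurableSet {z | b z = true} from
        hb (measurableSet_singleton true))]
    congr 1
    ext z
    simp
  rw [← integral_map hb.aemeasurable Measurable.of_discrete.aestronglyMeasurable,
    integral_fintype Integrable.of_finite]
  simp [htrue, hfalse, bitProb]

theorem measureReal_state_inter_bit [DiscreteMeasurableSpace Z] (ν : Measure Z)
    [IsProbabilityMeasure ν] (b : Z → Bool) (σ : Z → S) (s : S) (c : Bool) :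
    ν.real {z | σ z = s ∧ b z = c} =
      ν.real {z | σ z = s} * bitProb ((ν[|{z | σ z = s}]).real {z | b z = true}) c := by
  have hmul (c : Bool) : (ν[|{z | σ z = s}]).real {z | b z = c} * ν.real {z | σ z = s} =
      ν.real {z | σ z = s ∧ b z = c} := by
    rw [measureReal_def, measureReal_def, ← ENNReal.toReal_mul,
      cond_mul_eq_inter .of_discrete, Set.ofPred_and, measureReal_def]
  cases c
  · have hadd : ν.real {z | σ z = s ∧ b z = true} + ν.real {z | σ z = s ∧ b z = false} =
        ν.real {z | σ z = s} := by
      have hsdiff : {z | σ z = s ∧ b z = false} = {z | σ z = s} \ {z | b z = true} := by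
        ext z
        simp
      rw [hsdiff, Set.ofPred_and]
      exact measureReal_inter_add_sdiff .of_discrete
    simp only [bitProb, Bool.false_eq_true, if_false]
    linarith [hmul true]
  · rw [← hmul, mul_comm]
    rfl

theorem integral_integral_cond_fiber [Finite S] [MeasurableSpace S] [MeasurableSingletonClass S]
    {ν : Measure Z} [IsFiniteMeasure ν] {σ : Z → S} (hσ : Measurable σ) {f : Z → ℝ}
    (hf : Integrable f ν) :
    ∫ z, ∫ z', f z' ∂ν[|{z' | σ z' = σ z}] ∂ν = ∫ z, f z ∂ν := by
  have := Fintype.ofFinite S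
  have hfiber := sum_meas_smul_cond_fiber hσ ν
  have hint := integrable_finsetSum_measure.1 (hfiber.symm ▸ hf)
  conv_rhs => rw [← hfiber, integral_finsetSum_measure hint]
  rw [← integral_map (f := fun s => ∫ z', f z' ∂ν[|{z' | σ z' = s}]) hσ.aemeasurable
    (measurable_of_finite _).aestronglyMeasurable, integral_fintype .of_finite]
  refine Finset.sum_congr rfl fun s _ => ?_
  rw [integral_smul_measure, map_measureReal_apply hσ (measurableSet_singleton s)]
  rfl

theorem ae_measureReal_fiber_ne_zero [Countable Z] {ν : Measure Z} [IsFiniteMeasure ν]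
    {σ : Z → S} : ∀ᵐ z ∂ν, ν.real {z' | σ z' = σ z} ≠ 0 :=
  ae_iff_of_countable.2 fun z hz =>
    (ENNReal.toReal_pos (fun h => hz (measure_mono_null (by simp) h)) (measure_ne_top _ _)).ne'

end Conditioning

theorem erasureLaw_eq_bernoulliMeasure (ε : unitInterval) :
    erasureLaw ε = Ber(true, false, ε) := by
  rw [erasureLaw, bernoulliMeasure_def, ENNReal.ofReal_eq_coe_nnreal ε.2.1,
    ENNReal.ofReal_eq_coe_nnreal (unitInterval.one_minus_nonneg ε)]
  rfl

instance (ε : unitInterval) : IsProbabilityMeasure (erasureLaw ε) :=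
  erasureLaw_eq_bernoulliMeasure ε ▸ inferInstance

theorem comp_bernoulliMeasure_real {Y : Type*} [MeasurableSpace Y] (W : Kernel Bool Y)
    [IsMarkovKernel W] (p : unitInterval) (s : Set Y) :
    (W ∘ₘ Ber(true, false, p)).real s = p * (W true).real s + (1 - p) * (W false).real s := by
  have hfin (r : ℝ) (x : Bool) : (ENNReal.ofReal r • W x) s ≠ ∞ :=
    ENNReal.mul_ne_top ENNReal.ofReal_ne_top (measure_ne_top _ _)
  rw [← erasureLaw_eq_bernoulliMeasure, erasureLaw, Measure.comp_add, Measure.comp_smul,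
    Measure.comp_smul, Measure.dirac_bind W.measurable, Measure.dirac_bind W.measurable,
    measureReal_add_apply (hfin _ _) (hfin _ _)]
  simp [unitInterval.nonneg p, unitInterval.le_one p]

section Pipe

variable {Z S : Type*}

/-- Output of a bit-pipe with input `x`: the noisy bit and the state, unless there is an erasure.
The noise `ω.1` is abstract; `b` reads off its bit and `σ` its state. -/
def pipeOut (b : Z → Bool) (σ : Z → S) (x : Bool) (ω : Z × Bool) : Option (Bool × S) :=
  if ω.2 then none else some (x ^^ b ω.1, σ ω.1)

variable [MeasurableSpace Z]

/-- Mutual information in bits of a bit-pipe without erasures, for inputs that are `true` with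
probability `p`. -/
noncomputable def pipeInfo (ν : Measure Z) (b : Z → Bool) (σ : Z → S) (p : ℝ) : ℝ :=
  ∫ z, (binEnt (binConv p ((ν[|{z' | σ z' = σ z}]).real {z' | b z' = true}))
    - binEnt ((ν[|{z' | σ z' = σ z}]).real {z' | b z' = true})) ∂ν

theorem pipeInfo_zero (ν : Measure Z) (b : Z → Bool) (σ : Z → S) : pipeInfo ν b σ 0 = 0 := by
  simp [pipeInfo, binConv]

theorem pipeInfo_nonneg (ν : Measure Z) (b : Z → Bool) (σ : Z → S) {p : ℝ}
    (hp : p ∈ unitInterval) : 0 ≤ pipeInfo ν b σ p :=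
  integral_nonneg fun _ => sub_nonneg.2
    (binEnt_le_binEnt_binConv hp ⟨measureReal_nonneg, measureReal_le_one⟩)

theorem continuous_pipeInfo [Finite Z] [DiscreteMeasurableSpace Z] (ν : Measure Z)
    [IsFiniteMeasure ν] (b : Z → Bool) (σ : Z → S) : Continuous (pipeInfo ν b σ) := by
  have := Fintype.ofFinite Z
  unfold pipeInfo
  simp only [integral_fintype Integrable.of_finite]
  unfold binEnt binConv
  have := Real.binEntropy_continuous
  fun_prop

variable [MeasurableSpace (Option (Bool × S))]

/-- A bit-pipe as a channel: the noise has law `ν` and the erasure probability is `ε`. -/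
noncomputable def pipeKernel (ν : Measure Z) (ε : ℝ) (b : Z → Bool) (σ : Z → S) :
    Kernel Bool (Option (Bool × S)) where
  toFun x := (ν.prod (erasureLaw ε)).map (pipeOut b σ x)
  measurable' := .of_discrete

theorem pipeKernel_apply (ν : Measure Z) (ε : ℝ) (b : Z → Bool) (σ : Z → S) (x : Bool) :
    pipeKernel ν ε b σ x = (ν.prod (erasureLaw ε)).map (pipeOut b σ x) := rfl

variable [Countable Z] [DiscreteMeasurableSpace Z] {ν : Measure Z} [IsProbabilityMeasure ν]
  (ε : unitInterval) (b : Z → Bool) (σ : Z → S)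

instance : IsMarkovKernel (pipeKernel ν ε b σ) :=
  ⟨fun _ => Measure.isProbabilityMeasure_map Measurable.of_discrete.aemeasurable⟩

theorem memoryless_pipeKernel {ι : Type*} [Fintype ι] (x : ι → Bool) :
    memoryless (pipeKernel ν ε b σ) ι x =
      (Measure.pi fun _ => ν.prod (erasureLaw ε)).map fun ω t => pipeOut b σ (x t) (ω t) :=
  (Measure.pi_map_pi (f := fun t => pipeOut b σ (x t))
    fun _ => Measurable.of_discrete.aemeasurable).symm

variable [DiscreteMeasurableSpace (Option (Bool × S))]

theorem pipeKernel_real_none (x : Bool) : (pipeKernel ν ε b σ x).real {none} = ε := by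
  have hpre : pipeOut b σ x ⁻¹' {none} = Set.univ ×ˢ {true} := by
    ext ⟨z, e⟩
    cases e <;> simp [pipeOut]
  rw [pipeKernel_apply, map_measureReal_apply .of_discrete .of_discrete, hpre,
    measureReal_prod_prod, erasureLaw_eq_bernoulliMeasure]
  simp

theorem pipeKernel_real_some (x c : Bool) (s : S) :
    (pipeKernel ν ε b σ x).real {some (c, s)} = (1 - ε) * (ν.real {z | σ z = s} *
      bitProb ((ν[|{z | σ z = s}]).real {z | b z = true}) (x ^^ c)) := by
  have hpre : pipeOut b σ x ⁻¹' {some (c, s)} = {z | σ z = s ∧ b z = (x ^^ c)} ×ˢ {false} := by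
    ext ⟨z, e⟩
    have hxor : (x ^^ b z) = c ↔ b z = (x ^^ c) := by
      cases x <;> cases b z <;> cases c <;> simp
    cases e <;> simp [pipeOut, hxor, and_comm]
  rw [pipeKernel_apply, map_measureReal_apply .of_discrete .of_discrete, hpre,
    measureReal_prod_prod, measureReal_state_inter_bit, erasureLaw_eq_bernoulliMeasure, mul_comm]
  simp

theorem infoDensity_pipeKernel_none (p : unitInterval) (x : Bool) :
    infoDensity Ber(true, false, p) (pipeKernel ν ε b σ) (x, none) = 0 := by
  simp only [infoDensity, comp_bernoulliMeasure_real,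
    pipeKernel_real_none, ← add_mul, add_sub_cancel, one_mul]
  rcases eq_or_ne (ε : ℝ) 0 with h | h <;> simp [h]

theorem infoDensity_pipeKernel_some (p : unitInterval) {ε : unitInterval} (hε : ε ≠ 1) (x c : Bool)
    {s : S} (hs : ν.real {z | σ z = s} ≠ 0) :
    infoDensity Ber(true, false, p) (pipeKernel ν ε b σ) (x, some (c, s)) =
      Real.log (bitProb ((ν[|{z | σ z = s}]).real {z | b z = true}) (x ^^ c) /
        bitProb (binConv p ((ν[|{z | σ z = s}]).real {z | b z = true})) c) := by
  have hε' : 1 - (ε : ℝ) ≠ 0 := sub_ne_zero.2 fun h => hε (Subtype.ext h.symm)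
  simp only [infoDensity, comp_bernoulliMeasure_real, pipeKernel_real_some,
    bitProb_binConv, Bool.true_xor, Bool.false_xor]
  rw [← mul_div_mul_left (bitProb _ (x ^^ c)) _ (mul_ne_zero hε' hs)]
  ring_nf

theorem integral_cond_infoDensity_pipeKernel (p : unitInterval) {ε : unitInterval} (hε : ε ≠ 1)
    {s : S} (hs : ν.real {z | σ z = s} ≠ 0) :
    let J := infoDensity Ber(true, false, p) (pipeKernel ν ε b σ)
    let a := (ν[|{z | σ z = s}]).real {z | b z = true}
    p * ∫ z, J (true, some (true ^^ b z, σ z)) ∂ν[|{z | σ z = s}] +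
      (1 - p) * ∫ z, J (false, some (false ^^ b z, σ z)) ∂ν[|{z | σ z = s}] =
    Real.binEntropy (binConv p a) - Real.binEntropy a := by
  intro J a
  have := cond_isProbabilityMeasure (μ := ν) fun h => hs (by rw [measureReal_def, h]; rfl)
  have hinfo (x : Bool) : ∫ z, J (x, some (x ^^ b z, σ z)) ∂ν[|{z | σ z = s}] =
      ∑ c, bitProb a c * Real.log (bitProb a c / bitProb (binConv p a) (x ^^ c)) := by
    rw [← integral_comp_bool .of_discrete]
    refine integral_congr_ae ((ae_cond_mem .of_discrete).mono fun z hz => ?_)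
    simp only [Set.mem_ofPred_eq] at hz
    simp only [J, hz, infoDensity_pipeKernel_some b σ p hε x _ hs, ← Bool.xor_assoc, Bool.xor_self,
      Bool.false_xor, a]
  rw [hinfo, hinfo]
  simpa using sum_bitProb_mul_log_div p.2 ⟨measureReal_nonneg, measureReal_le_one⟩

end Pipe

section PipeCode

variable {Z S : Type*} [MeasurableSpace Z] [Finite Z] [DiscreteMeasurableSpace Z]
  [MeasurableSpace S] [Finite S] [DiscreteMeasurableSpace S]
  (ν : Measure Z) [IsProbabilityMeasure ν] (ε : unitInterval) (b : Z → Bool) (σ : Z → S)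

theorem mutualInfo_pipeKernel [MeasurableSpace (Option (Bool × S))]
    [DiscreteMeasurableSpace (Option (Bool × S))] (p : unitInterval) :
    mutualInfo Ber(true, false, p) (pipeKernel ν ε b σ) =
      (1 - ε) * (pipeInfo ν b σ p * Real.log 2) := by
  set J := infoDensity Ber(true, false, p) (pipeKernel ν ε b σ) with hJ
  have houter (x : Bool) : ∫ y, J (x, y) ∂(pipeKernel ν ε b σ x) =
      (1 - ε) * ∫ z, J (x, some (x ^^ b z, σ z)) ∂ν := by
    rw [pipeKernel_apply, integral_map Measurable.of_discrete.aemeasurable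
      Measurable.of_discrete.aestronglyMeasurable, integral_prod _ .of_finite,
      erasureLaw_eq_bernoulliMeasure]
    simp only [integral_bernoulliMeasure, pipeOut]
    simp [hJ, infoDensity_pipeKernel_none, integral_const_mul]
  rw [mutualInfo, Measure.integral_compProd .of_finite, integral_bernoulliMeasure]
  simp only [← hJ, houter, smul_eq_mul]
  rcases eq_or_ne ε 1 with rfl | hε
  · simp
  rw [mul_left_comm, mul_left_comm (1 - (p : ℝ)), ← mul_add, pipeInfo, ← integral_mul_const,
    ← integral_const_mul, ← integral_const_mul, ← integral_add .of_finite .of_finite,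
    ← integral_integral_cond_fiber (σ := σ) .of_discrete .of_finite]
  congr 1
  refine integral_congr_ae ((ae_measureReal_fiber_ne_zero (σ := σ)).mono fun z hz => ?_)
  simp only [binEnt, ← sub_div]
  rw [div_mul_cancel₀ _ (Real.log_pos one_lt_two).ne',
    ← integral_cond_infoDensity_pipeKernel b σ p hε hz, integral_add .of_finite .of_finite,
    integral_const_mul, integral_const_mul]

/-- The fraction of ones in a binary word. -/
noncomputable def freqOnes {n : ℕ} (x : Fin n → Bool) : ℝ :=
  ((Finset.univ.filter fun t => x t = true).card : ℝ) / n

theorem eventually_exists_pipe_code_abs_sub_lt (p : unitInterval) {δ : ℝ} (hδ : 0 < δ) :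
    ∀ᶠ n : ℕ in atTop, ∃ M : ℕ, (1 - ε) * pipeInfo ν b σ p - δ ≤ Real.logb 2 M / n ∧
      ∃ (c : Fin M → Fin n → Bool) (D : (Fin n → Option (Bool × S)) → Fin M), ∀ j,
        |freqOnes (c j) - p| < δ ∧
        (Measure.pi fun _ : Fin n => ν.prod (erasureLaw ε)).real
          {ω | D (fun t => pipeOut b σ (c j t) (ω t)) ≠ j} ≤ δ := by
  let : MeasurableSpace (Option (Bool × S)) := ⊤
  have hlog : 0 < Real.log 2 := Real.log_pos one_lt_two
  set η := min δ (δ * Real.log 2)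
  have hη0 : 0 < η := lt_min hδ (by positivity)
  filter_upwards [eventually_gt_atTop 0, eventually_exists_memoryless_code
    (P := Ber(true, false, p)) (W := pipeKernel ν ε b σ) (fun x => if x then 1 else 0) hη0]
    with n hn ⟨M, hM, c, D, hcD⟩
  have hn' : (0 : ℝ) < n := by exact_mod_cast hn
  refine ⟨M, ?_, c, D, fun j => ?_⟩
  · rw [mutualInfo_pipeKernel] at hM
    rw [le_div_iff₀ hn', Real.logb, le_div_iff₀ hlog]
    calc ((1 - ε) * pipeInfo ν b σ p - δ) * n * Real.log 2
        = n * ((1 - ε) * (pipeInfo ν b σ p * Real.log 2) - δ * Real.log 2) := by ring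
      _ ≤ n * ((1 - ε) * (pipeInfo ν b σ p * Real.log 2) - η) := by
          gcongr
          exact min_le_right _ _
      _ ≤ Real.log M := hM
  obtain ⟨hfreq, herr⟩ := hcD j
  constructor
  · have hsum : ∑ t, (if c j t then (1 : ℝ) else 0) = n * freqOnes (c j) := by
      rw [freqOnes, mul_div_cancel₀ _ hn'.ne']
      simp
    rw [hsum, integral_bernoulliMeasure] at hfreq
    simp only [if_true, smul_eq_mul, mul_one, Bool.false_eq_true, if_false, mul_zero, add_zero,
      ← mul_sub, abs_mul, Nat.abs_cast] at hfreq
    exact (lt_of_mul_lt_mul_left hfreq hn'.le).trans_le (min_le_left _ _)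
  · refine ENNReal.toReal_le_of_le_ofReal hδ.le ?_
    have hmeas : Measurable fun (ω : Fin n → Z × Bool) t => pipeOut b σ (c j t) (ω t) :=
      .of_discrete
    rw [memoryless_pipeKernel, Measure.map_apply hmeas .of_discrete] at herr
    exact herr.trans (ENNReal.ofReal_le_ofReal (min_le_left _ _))

theorem eventually_exists_pipe_code (p : unitInterval) {δ : ℝ} (hδ : 0 < δ) :
    ∀ᶠ n : ℕ in atTop, ∃ M : ℕ, (1 - ε) * pipeInfo ν b σ p - δ ≤ Real.logb 2 M / n ∧
      ∃ (c : Fin M → Fin n → Bool) (D : (Fin n → Option (Bool × S)) → Fin M), ∀ j,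
        freqOnes (c j) ∈ Set.Icc (p - δ) p ∧
        (Measure.pi fun _ : Fin n => ν.prod (erasureLaw ε)).real
          {ω | D (fun t => pipeOut b σ (c j t) (ω t)) ≠ j} ≤ δ := by
  rcases p.2.1.eq_or_lt with hp | hp
  · refine .of_forall fun n => ⟨1, ?_, fun _ _ => false, fun _ => 0, fun j => ?_⟩
    · simp [← hp, pipeInfo_zero, hδ.le]
    · simp [← hp, freqOnes, Subsingleton.elim (0 : Fin 1) j, hδ.le]
  have hclose : ∀ᶠ q in nhdsWithin (p : ℝ) (Set.Iio p),
      (1 - ε) * pipeInfo ν b σ p - δ / 2 < (1 - ε) * pipeInfo ν b σ q :=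
    ((continuous_const.mul (continuous_pipeInfo ν b σ)).tendsto (p : ℝ)
      |>.eventually_const_lt (sub_lt_self _ (half_pos hδ))).filter_mono nhdsWithin_le_nhds
  obtain ⟨q, hinfo, hq⟩ := (hclose.and (Ioo_mem_nhdsLT
    (max_lt hp (sub_lt_self (p : ℝ) (half_pos hδ))))).exists
  obtain ⟨hq0, hqδ⟩ := max_lt_iff.1 hq.1
  have hτ : 0 < min (p - q) (δ / 2) := lt_min (sub_pos.2 hq.2) (half_pos hδ)
  filter_upwards [eventually_exists_pipe_code_abs_sub_lt ν ε b σ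
    ⟨q, hq0.le, hq.2.le.trans p.2.2⟩ hτ] with n ⟨M, hM, c, D, hcD⟩
  have hτδ := min_le_right (p - q) (δ / 2)
  refine ⟨M, by linarith, c, D, fun j => ?_⟩
  obtain ⟨hfreq, herr⟩ := hcD j
  obtain ⟨hlower, hupper⟩ := abs_lt.1 hfreq
  have hτp := min_le_left (p - q) (δ / 2)
  exact ⟨⟨by linarith, by linarith⟩, by linarith⟩

end PipeCode

/-! ### Successive decoding -/

namespace SDScheme

variable {N : ℕ} {𝒜 : Fin N → Finset ℤ} {n : ℕ}

/-- The receiver's data `r` before it decodes bit-pipe `k` are correct: at the unerased times, `r.1`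
holds the noise bits below `k` and `r.2` is the carry-over into bit-pipe `k`. -/
def Reconstructs (c : SDScheme 𝒜 n) (m : ∀ i, Fin (c.M i)) (ω : Fin n → (Fin N → Bool) × Bool)
    (k : ℕ) (r : (Fin n → ℤ → Bool) × (Fin n → Bool)) : Prop :=
  ∀ t, (ω t).2 = false → (∀ j : ℤ, j < k → r.1 t j = extBit (ω t).1 j) ∧
    r.2 t = carryOver (c.inputBits m t) (ω t).1 k

/-- The decision on bit-pipe `i` when a genie reveals the state and the carry-over, so that the
decoder faces the output of the isolated bit-pipe. -/
def genieDecision (c : SDScheme 𝒜 n) (m : ∀ i, Fin (c.M i)) (ω : Fin n → (Fin N → Bool) × Bool)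
    (i : Fin N) : Fin (c.M i) :=
  c.dec i (fun t => (pipeOut (· i) (stateVec (𝒜 i)) (c.enc i (m i) t) (ω t)).map Prod.fst)
    (fun t => (pipeOut (· i) (stateVec (𝒜 i)) (c.enc i (m i) t) (ω t)).map Prod.snd)

theorem output_of_erased {c : SDScheme 𝒜 n} {m : ∀ i, Fin (c.M i)}
    {ω : Fin n → (Fin N → Bool) × Bool} {t : Fin n} (ht : (ω t).2 = true) :
    c.output m ω t = none := by
  rw [output, vbcErasedOut, if_pos ht]

theorem output_of_not_erased {c : SDScheme 𝒜 n} {m : ∀ i, Fin (c.M i)}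
    {ω : Fin n → (Fin N → Bool) × Bool} {t : Fin n} (ht : (ω t).2 = false) :
    c.output m ω t = some (vbcOut (c.inputBits m t) (ω t).1) := by
  rw [output, vbcErasedOut, ht, if_neg Bool.false_ne_true]

theorem Reconstructs.decision_eq_genieDecision {c : SDScheme 𝒜 n} {m : ∀ i, Fin (c.M i)}
    {ω : Fin n → (Fin N → Bool) × Bool} {i : Fin N} {r : (Fin n → ℤ → Bool) × (Fin n → Bool)}
    (hr : c.Reconstructs m ω i r) (hi : ∀ a ∈ 𝒜 i, a < (i : ℤ)) :
    c.decision (c.output m ω) i r.1 r.2 = c.genieDecision m ω i := by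
  unfold decision genieDecision
  congr 1 <;> funext t <;> cases ht : (ω t).2
  · simp [output_of_not_erased ht, pipeOut, ht, vbcOut, (hr t ht).2, inputBits]
  · simp [output_of_erased ht, pipeOut, ht]
  · have hstate : (fun a : 𝒜 i => r.1 t a) = stateVec (𝒜 i) (ω t).1 :=
      funext fun a => (hr t ht).1 a (hi a a.2)
    simp [output_of_not_erased ht, pipeOut, ht, hstate]
  · simp [output_of_erased ht, pipeOut, ht]

theorem reconstructs_receiver_zero (c : SDScheme 𝒜 n) (m : ∀ i, Fin (c.M i))
    (ω : Fin n → (Fin N → Bool) × Bool) :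
    c.Reconstructs m ω 0 (c.receiver (c.output m ω) 0) := by
  refine fun t _ => ⟨fun j hj => ?_, rfl⟩
  have hneg : ¬(0 ≤ j ∧ j < N) := fun h => h.1.not_gt (by exact_mod_cast hj)
  rw [extBit, dif_neg hneg]
  rfl

theorem Reconstructs.receiver_succ {c : SDScheme 𝒜 n} {m : ∀ i, Fin (c.M i)}
    {ω : Fin n → (Fin N → Bool) × Bool} {k : ℕ} (hk : k < N)
    (hr : c.Reconstructs m ω k (c.receiver (c.output m ω) k))
    (hdec : c.decoded (c.output m ω) ⟨k, hk⟩ = m ⟨k, hk⟩) :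
    c.Reconstructs m ω (k + 1) (c.receiver (c.output m ω) (k + 1)) := by
  intro t ht
  obtain ⟨hbits, hcarry⟩ := hr t ht
  have hnoise : ((c.output m ω t).elim false fun v =>
      (v ⟨k, hk⟩ ^^ carryOver (c.inputBits m t) (ω t).1 k) ^^ c.enc ⟨k, hk⟩ (m ⟨k, hk⟩) t) =
      (ω t).1 ⟨k, hk⟩ := by
    have hcancel (x z w : Bool) : ((((x ^^ z) ^^ w) ^^ w) ^^ x) = z := by
      cases x <;> cases z <;> cases w <;> rfl
    simp only [output_of_not_erased ht, Option.elim_some]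
    exact hcancel _ _ _
  rw [decoded] at hdec
  simp only [receiver, dif_pos hk, hdec, hcarry, hnoise, carryOver]
  refine ⟨fun j hj => ?_, rfl⟩
  rcases (show j ≤ k by push_cast at hj; omega).eq_or_lt with rfl | hj
  · rw [Function.update_self, extBit, dif_pos (by omega)]
    simp
  · rw [Function.update_of_ne hj.ne, hbits j hj]

theorem reconstructs_receiver {c : SDScheme 𝒜 n} (h𝒜 : ∀ i, ∀ a ∈ 𝒜 i, a < (i : ℤ))
    {m : ∀ i, Fin (c.M i)} {ω : Fin n → (Fin N → Bool) × Bool}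
    (hgenie : ∀ i, c.genieDecision m ω i = m i) {k : ℕ} (hk : k ≤ N) :
    c.Reconstructs m ω k (c.receiver (c.output m ω) k) := by
  induction k with
  | zero => exact reconstructs_receiver_zero c m ω
  | succ k ih =>
    have hr := ih (Nat.le_of_succ_le hk)
    exact hr.receiver_succ hk
      ((hr.decision_eq_genieDecision (i := ⟨k, hk⟩) (h𝒜 _)).trans (hgenie _))

theorem decoded_eq_of_genieDecision_eq {c : SDScheme 𝒜 n} (h𝒜 : ∀ i, ∀ a ∈ 𝒜 i, a < (i : ℤ))
    {m : ∀ i, Fin (c.M i)} {ω : Fin n → (Fin N → Bool) × Bool}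
    (hgenie : ∀ i, c.genieDecision m ω i = m i) (i : Fin N) :
    c.decoded (c.output m ω) i = m i :=
  ((reconstructs_receiver h𝒜 hgenie i.2.le).decision_eq_genieDecision (h𝒜 i)).trans (hgenie i)

/-- The state-assisted scheme that is made of one code for each isolated bit-pipe. Its decoders zip
the two streams, which are erased simultaneously. -/
def ofPipeCodes {M : Fin N → ℕ} (enc : ∀ i, Fin (M i) → Fin n → Bool)
    (D : ∀ i, (Fin n → Option (Bool × (𝒜 i → Bool))) → Fin (M i)) : SDScheme 𝒜 n where
  M := M
  enc := enc
  dec i y s := D i fun t => (y t).bind fun a => (s t).map (Prod.mk a)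

theorem genieDecision_ofPipeCodes {M : Fin N → ℕ} (enc : ∀ i, Fin (M i) → Fin n → Bool)
    (D : ∀ i, (Fin n → Option (Bool × (𝒜 i → Bool))) → Fin (M i)) (m : ∀ i, Fin (M i))
    (ω : Fin n → (Fin N → Bool) × Bool) (i : Fin N) :
    (ofPipeCodes enc D).genieDecision m ω i =
      D i fun t => pipeOut (· i) (stateVec (𝒜 i)) (enc i (m i) t) (ω t) := by
  refine congrArg (D i) (funext fun t => ?_)
  cases h : (ω t).2 <;> simp [ofPipeCodes, pipeOut, h]

end SDScheme

/-! ### Intensity constraints -/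

theorem sum_filter_ne_zero_mul {ι : Type*} [Fintype ι] (p a : ι → ℝ) :
    ∑ i with p i ≠ 0, p i * a i = ∑ i, p i * a i :=
  Finset.sum_filter_of_ne fun _ _ => left_ne_zero_of_mul

theorem eq_false_of_freqOnes_nonpos {n : ℕ} {x : Fin n → Bool} (h : freqOnes x ≤ 0) (t : Fin n) :
    x t = false := by
  have hn : (0 : ℝ) < n := by exact_mod_cast t.pos
  rw [freqOnes, div_le_iff₀ hn, zero_mul, Nat.cast_nonpos, Finset.card_eq_zero,
    Finset.filter_eq_empty_iff] at h
  simpa using h (Finset.mem_univ t)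

namespace SDScheme

variable {N n : ℕ} {𝒜 : Fin N → Finset ℤ}

theorem intensity_le (c : SDScheme 𝒜 n) {A γ : ℝ} (hγ : 0 < γ) {p : Fin N → ℝ}
    (hzero : ∀ i, p i = 0 → ∀ m t, c.enc i m t = false)
    (hpeak : ∑ i with p i ≠ 0, (2 : ℝ) ^ (i : ℕ) ≤ γ * A) (m : ∀ i, Fin (c.M i)) (t : Fin n) :
    c.intensity γ m t ≤ A := by
  rw [intensity, div_le_iff₀' hγ, ← Finset.sum_filter]
  refine le_trans (Finset.sum_le_sum_of_subset_of_nonneg ?_ fun _ _ _ => by positivity) hpeak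
  intro i hi
  rw [Finset.mem_filter_univ] at hi ⊢
  exact fun hpi => Bool.false_ne_true ((hzero i hpi (m i) t).symm.trans hi)

theorem sum_intensity_div (c : SDScheme 𝒜 n) (γ : ℝ) (m : ∀ i, Fin (c.M i)) :
    (∑ t, c.intensity γ m t) / n = (∑ i, freqOnes (c.enc i (m i)) * 2 ^ (i : ℕ)) / γ := by
  have hcount (i : Fin N) : ∑ t, (if c.inputBits m t i then (2 : ℝ) ^ (i : ℕ) else 0) =
      (Finset.univ.filter fun t => c.enc i (m i) t = true).card * 2 ^ (i : ℕ) := by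
    rw [← Finset.sum_filter, Finset.sum_const, nsmul_eq_mul]
    rfl
  simp only [intensity, freqOnes, div_mul_eq_mul_div]
  rw [← Finset.sum_div, Finset.sum_comm, div_right_comm, Finset.sum_div]
  simp only [hcount]

theorem admissible_of_freqOnes_mem_Icc {A E β γ : ℝ} (hγ : 0 < γ)
    {𝒜 : Fin (numPipes A β γ) → Finset ℤ} {p : Fin (numPipes A β γ) → ℝ}
    (hp : p ∈ feasibleInputs A E β γ) {δ : ℝ} (c : SDScheme 𝒜 n)
    (hfreq : ∀ i m, freqOnes (c.enc i m) ∈ Set.Icc (p i - δ) (p i)) :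
    c.Admissible A E γ p δ := by
  obtain ⟨-, hpeak, henergy⟩ := hp
  have hzero : ∀ i, p i = 0 → ∀ m t, c.enc i m t = false := fun i hi m =>
    eq_false_of_freqOnes_nonpos ((hfreq i m).2.trans_eq hi)
  refine ⟨hzero, fun i m => ?_, c.intensity_le hγ hzero hpeak, fun m => ?_⟩
  · obtain ⟨hlower, hupper⟩ := hfreq i m
    have habs : |freqOnes (c.enc i m) - p i| ≤ δ := abs_le.2 ⟨by linarith, by linarith⟩
    exact habs
  · rw [sum_intensity_div, div_le_iff₀' hγ]
    rw [sum_filter_ne_zero_mul] at henergy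
    refine le_trans (Finset.sum_le_sum fun i _ => ?_) henergy
    gcongr
    exact (hfreq i (m i)).2

end SDScheme

/-! ### The noise law and the erasure probability -/

theorem gaussianReal_noiseSupport_ne_zero {A β γ : ℝ} (hA : 0 ≤ A) (hβ : 0 < β) (hγ : 0 < γ) :
    gaussianReal 0 1 (noiseSupport A β γ) ≠ 0 := by
  have hsub : Set.Ioo (-β) (A + β) ⊆ noiseSupport A β γ := by
    intro z hz
    have hlower : 0 < γ * (z + β) := mul_pos hγ (by linarith [hz.1])
    have hupper : γ * (z + β) < γ * (A + 2 * β) :=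
      mul_lt_mul_of_pos_left (by linarith [hz.2]) hγ
    have hceil : (0 : ℝ) ≤ ⌈γ * A⌉ := (mul_nonneg hγ.le hA).trans (Int.le_ceil _)
    exact ⟨by linarith, hupper.trans_le (Int.le_ceil _)⟩
  intro h
  have hvol := gaussianReal_absolutelyContinuous' 0 one_ne_zero (measure_mono_null hsub h)
  rw [Real.volume_Ioo, ENNReal.ofReal_eq_zero] at hvol
  linarith

theorem isProbabilityMeasure_noiseLaw {A β γ : ℝ} (hA : 0 ≤ A) (hβ : 0 < β) (hγ : 0 < γ) :
    IsProbabilityMeasure (noiseLaw A β γ) :=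
  have := cond_isProbabilityMeasure (gaussianReal_noiseSupport_ne_zero hA hβ hγ)
  Measure.isProbabilityMeasure_map (measurable_noiseBits _ _ _).aemeasurable

theorem gaussQ_zero : gaussQ 0 = 1 / 2 := by
  have hgauss : ∫ u in Set.Ioi (0 : ℝ), Real.exp (-u ^ 2 / 2) = Real.sqrt (2 * Real.pi) / 2 := by
    convert integral_gaussian_Ioi (1 / 2) using 4 <;> ring
  have hsqrt : Real.sqrt (2 * Real.pi) ≠ 0 := by positivity
  rw [gaussQ, hgauss]
  field_simp

theorem antitone_gaussQ : Antitone gaussQ := by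
  have hint : Integrable fun u : ℝ => Real.exp (-u ^ 2 / 2) := by
    convert integrable_exp_neg_mul_sq one_half_pos using 3
    ring
  intro x y hxy
  have hmono := setIntegral_mono_set hint.integrableOn (ae_of_all _ fun u => (Real.exp_pos _).le)
    (Set.Ioi_subset_Ioi hxy).eventuallyLE
  exact mul_le_mul_of_nonneg_left hmono (by positivity)

theorem epsBar_le_one {β : ℝ} (hβ : 0 ≤ β) : epsBar β ≤ 1 := by
  have := antitone_gaussQ hβ
  rw [gaussQ_zero] at this
  rw [epsBar]
  linarith

/-! ### Existence of the maximum -/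

theorem feasibleInputs_eq_iUnion (A E β γ : ℝ) :
    feasibleInputs A E β γ =
      ⋃ T ∈ {T : Finset (Fin (numPipes A β γ)) | ∑ i ∈ T, (2 : ℝ) ^ (i : ℕ) ≤ γ * A},
        Set.univ.pi (fun i => if i ∈ T then Set.Icc 0 1 else {0}) ∩
          {p | ∑ i, p i * (2 : ℝ) ^ (i : ℕ) ≤ γ * E} := by
  ext p
  simp only [feasibleInputs, Set.mem_iUnion, Set.mem_inter_iff, Set.mem_univ_pi,
    Set.mem_ofPred_eq, exists_prop, sum_filter_ne_zero_mul]
  constructor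
  · rintro ⟨hp, hpeak, henergy⟩
    refine ⟨_, hpeak, fun i => ?_, henergy⟩
    split_ifs with hi
    · exact hp i
    · simpa using hi
  · rintro ⟨T, hpeak, hp, henergy⟩
    refine ⟨fun i => ?_, le_trans (Finset.sum_le_sum_of_subset_of_nonneg ?_
      fun _ _ _ => by positivity) hpeak, henergy⟩
    · have hi := hp i
      split_ifs at hi
      · exact hi
      · simp [Set.mem_singleton_iff.1 hi]
    · intro i hi
      by_contra hiT
      have hpi := hp i
      rw [if_neg hiT] at hpi
      exact (Finset.mem_filter.1 hi).2 hpi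

theorem isCompact_feasibleInputs (A E β γ : ℝ) : IsCompact (feasibleInputs A E β γ) := by
  rw [feasibleInputs_eq_iUnion]
  refine (Set.toFinite _).isCompact_biUnion fun T _ => IsCompact.inter_right
    (isCompact_univ_pi fun i => ?_) (isClosed_le (by fun_prop) continuous_const)
  split_ifs
  exacts [isCompact_Icc, isCompact_singleton]

theorem sdSum_eq_sum_pipeInfo (A β γ : ℝ) (𝒜 : Fin (numPipes A β γ) → Finset ℤ)
    (p : Fin (numPipes A β γ) → ℝ) :
    sdSum A β γ 𝒜 p = ∑ i, pipeInfo (noiseLaw A β γ) (· i) (stateVec (𝒜 i)) (p i) := rfl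

theorem sdSum_nonneg {A β γ : ℝ} (𝒜 : Fin (numPipes A β γ) → Finset ℤ)
    {p : Fin (numPipes A β γ) → ℝ} (hp : ∀ i, p i ∈ unitInterval) : 0 ≤ sdSum A β γ 𝒜 p :=
  Finset.sum_nonneg fun i _ => pipeInfo_nonneg _ _ _ (hp i)

theorem continuous_sdSum (A β γ : ℝ) [IsFiniteMeasure (noiseLaw A β γ)]
    (𝒜 : Fin (numPipes A β γ) → Finset ℤ) : Continuous (sdSum A β γ 𝒜) :=
  continuous_finsetSum _ fun i _ =>
    (continuous_pipeInfo (noiseLaw A β γ) (· i) (stateVec (𝒜 i))).comp (continuous_apply i)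

theorem exists_isMaxOn_sdSum {A E β γ : ℝ} (hA : 0 ≤ A) (hE : 0 ≤ E) (hγ : 0 ≤ γ)
    [IsFiniteMeasure (noiseLaw A β γ)] (𝒜 : Fin (numPipes A β γ) → Finset ℤ) :
    ∃ p ∈ feasibleInputs A E β γ, IsMaxOn (sdSum A β γ 𝒜) (feasibleInputs A E β γ) p :=
  (isCompact_feasibleInputs A E β γ).exists_isMaxOn
    ⟨0, by simp [feasibleInputs, mul_nonneg hγ hA, mul_nonneg hγ hE]⟩
    (continuous_sdSum A β γ 𝒜).continuousOn

/-! ### Achievability -/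

theorem sdErrorProb_ofPipeCodes_le {A β γ : ℝ} (ε : unitInterval)
    {𝒜 : Fin (numPipes A β γ) → Finset ℤ} (h𝒜 : ∀ i, ∀ a ∈ 𝒜 i, a < (i : ℤ)) {n : ℕ}
    [IsProbabilityMeasure (noiseLaw A β γ)] {M : Fin (numPipes A β γ) → ℕ}
    (enc : ∀ i, Fin (M i) → Fin n → Bool)
    (D : ∀ i, (Fin n → Option (Bool × (𝒜 i → Bool))) → Fin (M i)) (m : ∀ i, Fin (M i)) :
    sdErrorProb A β γ ε (SDScheme.ofPipeCodes enc D) m ≤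
      ∑ i, (Measure.pi fun _ : Fin n => (noiseLaw A β γ).prod (erasureLaw ε)).real
        {ω | D i (fun t => pipeOut (· i) (stateVec (𝒜 i)) (enc i (m i) t) (ω t)) ≠ m i} := by
  unfold sdErrorProb blockLaw
  refine (measureReal_mono fun ω hω => ?_).trans (measureReal_iUnion_fintype_le _)
  by_contra hgenie
  simp only [Set.mem_iUnion, Set.mem_ofPred_eq, not_exists, not_not] at hgenie
  obtain ⟨i, hi⟩ := hω
  exact hi (SDScheme.decoded_eq_of_genieDecision_eq h𝒜
    (fun i => (SDScheme.genieDecision_ofPipeCodes enc D m ω i).trans (hgenie i)) i)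

theorem SDAchieves.mono {A E β γ ε : ℝ} {𝒜 : Fin (numPipes A β γ) → Finset ℤ}
    {p : Fin (numPipes A β γ) → ℝ} {R R' : ℝ} (h : SDAchieves A E β γ ε 𝒜 p R) (hR : R' ≤ R) :
    SDAchieves A E β γ ε 𝒜 p R' := fun δ hδ =>
  (h δ hδ).mono fun _ ⟨c, hadm, hrate, herr⟩ => ⟨c, hadm, by linarith, herr⟩

theorem sdAchieves_of_mem_feasibleInputs {A E β γ : ℝ} (hγ : 0 < γ)
    [IsProbabilityMeasure (noiseLaw A β γ)] (ε : unitInterval)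
    {𝒜 : Fin (numPipes A β γ) → Finset ℤ} (h𝒜 : ∀ i, ∀ a ∈ 𝒜 i, a < (i : ℤ))
    {p : Fin (numPipes A β γ) → ℝ} (hp : p ∈ feasibleInputs A E β γ) :
    SDAchieves A E β γ ε 𝒜 p ((1 - ε) * sdSum A β γ 𝒜 p) := by
  intro δ hδ
  set η := δ / (numPipes A β γ + 1) with hη
  have hη0 : 0 < η := by positivity
  have hηδ : η ≤ δ := div_le_self hδ.le (by simp)
  have hNη : numPipes A β γ * η ≤ δ := by
    rw [hη, mul_div_assoc', div_le_iff₀ (by positivity)]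
    linarith
  have hcodes := eventually_all.2 fun i => eventually_exists_pipe_code (noiseLaw A β γ) ε
    (· i) (stateVec (𝒜 i)) ⟨p i, hp.1 i⟩ hη0
  filter_upwards [hcodes] with n hcode
  choose M hrate enc D hfreq herr using hcode
  refine ⟨SDScheme.ofPipeCodes enc D, SDScheme.admissible_of_freqOnes_mem_Icc hγ hp _
    fun i m => Set.Icc_subset_Icc_left (by linarith) (hfreq i m), ?_, fun m => ?_⟩
  · calc (1 - ε) * sdSum A β γ 𝒜 p - δ
        ≤ (1 - ε) * sdSum A β γ 𝒜 p - numPipes A β γ * η := by gcongr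
      _ = ∑ i, ((1 - ε) * pipeInfo (noiseLaw A β γ) (· i) (stateVec (𝒜 i)) (p i) - η) := by
        simp [sdSum_eq_sum_pipeInfo, Finset.mul_sum]
      _ ≤ ∑ i, Real.logb 2 (M i) / n := Finset.sum_le_sum fun i _ => hrate i
      _ = (∑ i, Real.logb 2 (M i)) / n := (Finset.sum_div _ _ _).symm
  · calc sdErrorProb A β γ ε (SDScheme.ofPipeCodes enc D) m
        ≤ _ := sdErrorProb_ofPipeCodes_le ε h𝒜 enc D m
      _ ≤ ∑ _i : Fin (numPipes A β γ), η := Finset.sum_le_sum fun i _ => herr i (m i)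
      _ = numPipes A β γ * η := by simp
      _ ≤ δ := hNη

theorem theorem3_general (A E β γ : ℝ) (hA : 0 ≤ A) (hE : 0 ≤ E) (hβ : 0 < β) (hγ : 0 < γ)
    (𝒜 : Fin (numPipes A β γ) → Finset ℤ) (h𝒜 : ∀ i, ∀ a ∈ 𝒜 i, a < (i : ℤ)) :
    ∃ p ∈ feasibleInputs A E β γ,
      IsMaxOn (sdSum A β γ 𝒜) (feasibleInputs A E β γ) p ∧
      ∀ ε : unitInterval, SDAchieves A E β γ ε 𝒜 p ((1 - ε) * sdSum A β γ 𝒜 p) := by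
  have := isProbabilityMeasure_noiseLaw hA hβ hγ
  obtain ⟨p, hp, hmax⟩ := exists_isMaxOn_sdSum hA hE hγ.le 𝒜
  exact ⟨p, hp, hmax, fun ε => sdAchieves_of_mem_feasibleInputs hγ ε h𝒜 hp⟩

theorem theorem3 (A E β γ : ℝ) (hA : 0 < A) (hE : 0 < E) (hβ : 0 < β) (hγ : 0 < γ)
    (q : ℕ) (hq : 1 ≤ q) (hqN : q ≤ numPipes A β γ - 1)
    (𝒜 : Fin (numPipes A β γ) → Finset ℤ)
    (h𝒜 : ∀ i, (𝒜 i).card = q ∧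
      𝒜 i ⊆ Finset.Icc ((i : ℤ) - (numPipes A β γ : ℤ) + 1) ((i : ℤ) - 1)) :
    ∃ p ∈ feasibleInputs A E β γ,
      IsMaxOn (sdSum A β γ 𝒜) (feasibleInputs A E β γ) p ∧
      ∀ ε : ℝ, 0 ≤ ε → ε ≤ epsBar β →
        SDAchieves A E β γ ε 𝒜 p ((1 - epsBar β) * sdSum A β γ 𝒜 p) := by
  have h𝒜' : ∀ i, ∀ a ∈ 𝒜 i, a < (i : ℤ) := fun i a ha =>
    Int.lt_of_le_sub_one (Finset.mem_Icc.1 ((h𝒜 i).2 ha)).2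
  obtain ⟨p, hp, hmax, hach⟩ := theorem3_general A E β γ hA.le hE.le hβ hγ 𝒜 h𝒜'
  refine ⟨p, hp, hmax, fun ε hε0 hε => ?_⟩
  refine (hach ⟨ε, hε0, hε.trans (epsBar_le_one hβ.le)⟩).mono ?_
  gcongr
  exact sdSum_nonneg 𝒜 hp.1
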